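/- Setting. Let $e_i := z^{-i-1}$ ($i\in\mathbf Z$) be the standard basis of the space $\mathcal H$ of formal complex series in $z,z^{-1}$ with finitely many positive powers of $z$. Let $A=(A_{ij})_{i,j\in\mathbf Z}$ be a complex doubly infinite lower triangular matrix ($A_{ij}=0$ for $j>i$), let $g=e^A$ (entrywise convergent, hence invertible and lower triangular), and let $g$ act on $\mathcal H$ by $g(e_i)=\sum_j e_j g_{ji}$. With $\tilde g_{ij}:=g_{-i-1,-j-1}$, define for $k\in\mathbf Z$ the adapted bases $$w^g_k(z):=g(z^{k-1})=\sum_{j\in\mathbf Z} g_{-j-1,-k}\,z^j,\qquad w^{g*}_k(z):=(\tilde g^{\,t})^{-1}(z^{k-1})=\sum_{j\in\mathbf Z}(g^{-1})_{k-1,j}\,z^j .$$ On the fermionic Fock space (semi-infinite wedge space) spanned by the $e_{\ell_1}\wedge e_{\ell_2}\wedge\cdots$ with $\ell_1>\ell_2>\cdots$ eventually consecutive, completed so that arbitrary infinite linear combinations of these basis elements are allowed, let $\psi_i=e_i\wedge$ and let $\psi_i^*$ be interior multiplication by the dual basis element of $e_i$. Let $|0\rangle=e_{-1}\wedge e_{-2}\wedge\cdots$,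 let $\langle 0|$ be the functional giving the coefficient of $|0\rangle$, and put $$\psi(z)=\sum_{i\in\mathbf Z}\psi_i z^i,\qquad \psi^*(z)=\sum_{i\in\mathbf Z}\psi^*_i z^{-i-1},\qquad \hat g:=\exp\Big(\sum_{i,j\in\mathbf Z}A_{ij}:\!\psi_i\psi_j^*\!:\Big),$$ where $:\ :$ is normal ordering with respect to $|0\rangle$. Proposition. The exponential series defining $\hat g$ converges componentwise to an invertible operator on the completed Fock space, and for every $k\in\mathbf Z$, as identities of formal series in $z$ (coefficient by coefficient), $$w_k^g(z)=\begin{cases}\langle 0|\psi_{-k}\,\hat g^{-1}\psi^*(z)\,\hat g|0\rangle & k\ge 1,\\ \langle 0|\hat g^{-1}\psi^*(z)\,\hat g\,\psi_{-k}|0\rangle & k\le 0,\end{cases}\qquad w_k^{g*}(z)=\begin{cases}\langle 0|\psi^*_{k-1}\,\hat g^{-1}\psi(z)\,\hat g|0\rangle & k\ge 1,\\ \langle 0|\hat g^{-1}\psi(z)\,\hat g\,\psi^*_{k-1}|0\rangle & k\le 0.\end{cases}$$ -/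

import Mathlib

open scoped Nat

/-! ### Lower triangular doubly infinite matrices -/

/-- The ring of complex `ℤ × ℤ` matrices `g` with `g i j = 0` for `j > i`. For such matrices every
entry of a product is a finite sum. -/
abbrev LowerTri : Type := IncidenceAlgebra ℂ ℤᵒᵈ

namespace LowerTri

/-- The matrix entry `g_{ij}`. -/
def entry (g : LowerTri) (i j : ℤ) : ℂ := g (OrderDual.toDual i) (OrderDual.toDual j)

theorem entry_eq_zero (g : LowerTri) {i j : ℤ} (h : i < j) : g.entry i j = 0 :=
  IncidenceAlgebra.apply_eq_zero_of_not_le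
    (fun h' => absurd (OrderDual.toDual_le_toDual.mp h') (not_le.mpr h)) g

theorem entry_ext {g h : LowerTri} (H : ∀ i j, g.entry i j = h.entry i j) : g = h :=
  IncidenceAlgebra.ext fun i j _ => H (OrderDual.ofDual i) (OrderDual.ofDual j)

theorem entry_mul (g h : LowerTri) (i j : ℤ) :
    (g * h).entry i j = ∑ l ∈ Finset.Icc j i, g.entry i l * h.entry l j := by
  unfold entry
  rw [IncidenceAlgebra.mul_apply]
  exact Finset.sum_bij (fun a _ => OrderDual.ofDual a)
    (fun a ha => by
      rw [Finset.mem_Icc] at ha ⊢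
      exact ⟨ha.2, ha.1⟩)
    (fun _ _ _ _ h => h)
    (fun b hb => ⟨OrderDual.toDual b, by
      rw [Finset.mem_Icc] at hb ⊢
      exact ⟨hb.2, hb.1⟩, rfl⟩)
    (fun _ _ => rfl)

theorem entry_one (i j : ℤ) : (1 : LowerTri).entry i j = if i = j then 1 else 0 := by
  unfold entry
  rw [IncidenceAlgebra.one_apply]
  simp

/-- `g = e^A`, i.e. `g_{ij} = ∑ₙ (Aⁿ)_{ij} / n!` for all `i, j`. -/
def IsExp (A g : LowerTri) : Prop :=
  ∀ i j : ℤ, HasSum (fun n : ℕ => ((n ! : ℂ))⁻¹ * (A ^ n).entry i j) (g.entry i j)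

/-- The matrix `g̃ᵗ`, where `g̃ = ι ∘ g ∘ ι` has entries `g̃_{ij} = g_{-i-1,-j-1}`. -/
noncomputable def tildeT (g : LowerTri) : LowerTri where
  toFun i j := g.entry (-OrderDual.ofDual j - 1) (-OrderDual.ofDual i - 1)
  eq_zero_of_not_le' i j h := by
    apply entry_eq_zero
    have h' : ¬ (OrderDual.ofDual j ≤ OrderDual.ofDual i) := h
    omega

theorem entry_tildeT (g : LowerTri) (i j : ℤ) :
    (tildeT g).entry i j = g.entry (-j - 1) (-i - 1) := rfl

theorem tildeT_mul (g h : LowerTri) : tildeT (g * h) = tildeT h * tildeT g := by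
  apply entry_ext
  intro i j
  rw [entry_tildeT, entry_mul, entry_mul]
  refine Finset.sum_bij (fun a _ => -a - 1) ?_ ?_ ?_ ?_
  · intro a ha
    rw [Finset.mem_Icc] at ha ⊢
    omega
  · intro a _ b _ hab
    omega
  · intro b hb
    rw [Finset.mem_Icc] at hb
    exact ⟨-b - 1, by rw [Finset.mem_Icc]; omega, by omega⟩
  · intro a _
    rw [entry_tildeT, entry_tildeT, show -(-a - 1) - 1 = a by ring, mul_comm]

theorem tildeT_one : tildeT 1 = 1 := by
  apply entry_ext
  intro i j
  rw [entry_tildeT, entry_one, entry_one]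
  congr 1
  exact propext ⟨fun h => by omega, fun h => by omega⟩

/-- `g̃ᵗ` as an invertible matrix, for invertible `g`. -/
noncomputable def tildeTUnit (g : LowerTriˣ) : LowerTriˣ where
  val := tildeT g
  inv := tildeT (↑g⁻¹ : LowerTri)
  val_inv := by rw [← tildeT_mul, Units.inv_mul, tildeT_one]
  inv_val := by rw [← tildeT_mul, Units.mul_inv, tildeT_one]

end LowerTri

/-! ### Formal series and adapted bases -/

/-- Formal series `∑_{n ∈ ℤ} f n zⁿ` in `z, z⁻¹`. -/
abbrev FormalSeries : Type := ℤ → ℂ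

/-- The space `ℋ` of formal series with only finitely many positive powers of `z`, on which all
lower triangular matrices act. -/
def SeriesSpace : Submodule ℂ FormalSeries where
  carrier := {f | ∃ N : ℤ, ∀ n, N < n → f n = 0}
  zero_mem' := ⟨0, fun _ _ => rfl⟩
  add_mem' := by
    rintro f h ⟨M, hM⟩ ⟨N, hN⟩
    refine ⟨max M N, fun n hn => ?_⟩
    simp [hM n (lt_of_le_of_lt (le_max_left _ _) hn), hN n (lt_of_le_of_lt (le_max_right _ _) hn)]
  smul_mem' := by
    rintro c f ⟨M, hM⟩
    exact ⟨M, fun n hn => by simp [hM n hn]⟩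

/-- The monomial `z^m`. -/
noncomputable def zMonomial (m : ℤ) : SeriesSpace :=
  ⟨fun n => if n = m then 1 else 0, m, fun n hn => by simp [hn.ne']⟩

/-- The coefficient `f_j` in the expansion `f = ∑ⱼ f_j e_j` in the basis `e_j = z^{-j-1}`. -/
def eCoeff (f : FormalSeries) (j : ℤ) : ℂ := f (-j - 1)

theorem LowerTri.finite_support (g : LowerTri) (f : SeriesSpace) (i : ℤ) :
    (Function.support fun j => g.entry i j * eCoeff f j).Finite := by
  obtain ⟨f, N, hN⟩ := f
  refine (Set.finite_Icc (-N - 1) i).subset fun j hj => ?_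
  rw [Function.mem_support] at hj
  refine ⟨?_, ?_⟩
  · by_contra h
    exact hj (by simp [eCoeff, hN (-j - 1) (by omega)])
  · by_contra h
    exact hj (by rw [g.entry_eq_zero (by omega), zero_mul])

/-- The endomorphism of `ℋ` with `g (e_j) = ∑ᵢ e_i g_{ij}`, i.e. `(g f)_i = ∑ⱼ g_{ij} f_j` (a finite
sum) with respect to the basis `e_i = z^{-i-1}`. -/
noncomputable def LowerTri.act (g : LowerTri) : SeriesSpace →ₗ[ℂ] SeriesSpace where
  toFun f := ⟨fun n => ∑ᶠ j, g.entry (-n - 1) j * eCoeff f j, by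
    obtain ⟨N, hN⟩ := f.2
    refine ⟨N, fun n hn => finsum_eq_zero_of_forall_eq_zero fun j => ?_⟩
    by_cases h : -n - 1 < j
    · rw [g.entry_eq_zero h, zero_mul]
    · simp [eCoeff, hN (-j - 1) (by omega)]⟩
  map_add' f h := by
    ext n
    change (∑ᶠ j, g.entry (-n - 1) j * eCoeff ((f : FormalSeries) + h) j) =
      (∑ᶠ j, g.entry (-n - 1) j * eCoeff f j) + ∑ᶠ j, g.entry (-n - 1) j * eCoeff h j
    rw [← finsum_add_distrib (g.finite_support f _) (g.finite_support h _)]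
    exact finsum_congr fun j => by simp [eCoeff, mul_add]
  map_smul' c f := by
    ext n
    change (∑ᶠ j, g.entry (-n - 1) j * eCoeff (c • (f : FormalSeries)) j) =
      c * ∑ᶠ j, g.entry (-n - 1) j * eCoeff f j
    rw [mul_finsum' _ _ (g.finite_support f _)]
    exact finsum_congr fun j => by simp [eCoeff, mul_left_comm]

/-- The adapted basis `w^g_k(z) = g(z^{k-1})`. -/
noncomputable def adaptedBasis (g : LowerTriˣ) (k : ℤ) : SeriesSpace :=
  (g : LowerTri).act (zMonomial (k - 1))

/-- The dual adapted basis `w^{g*}_k(z) = (g̃ᵗ)⁻¹(z^{k-1})`. -/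
noncomputable def dualAdaptedBasis (g : LowerTriˣ) (k : ℤ) : SeriesSpace :=
  (↑(LowerTri.tildeTUnit g)⁻¹ : LowerTri).act (zMonomial (k - 1))

/-! ### Fermionic Fock space -/

/-- The set of occupied sites `{ℓ₁ > ℓ₂ > ⋯}` of a basis element `e_{ℓ₁} ∧ e_{ℓ₂} ∧ ⋯` of the
semi-infinite wedge space: it contains finitely many `i ≥ 0` and all but finitely many `i < 0`. -/
@[ext] structure Maya where
  occ : Set ℤ
  finite_particles : {i | 0 ≤ i ∧ i ∈ occ}.Finite
  finite_holes : {i | i < 0 ∧ i ∉ occ}.Finite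

namespace Maya

/-- Fill the site `i`. -/
def fill (S : Maya) (i : ℤ) : Maya where
  occ := insert i S.occ
  finite_particles := (S.finite_particles.insert i).subset fun j hj => by
    rcases hj.2 with h | h
    · exact Or.inl h
    · exact Or.inr ⟨hj.1, h⟩
  finite_holes := S.finite_holes.subset fun _ hj => ⟨hj.1, fun h => hj.2 (Or.inr h)⟩

/-- Empty the site `i`. -/
def clear (S : Maya) (i : ℤ) : Maya where
  occ := S.occ \ {i}
  finite_particles := S.finite_particles.subset fun _ hj => ⟨hj.1, hj.2.1⟩
  finite_holes := (S.finite_holes.insert i).subset fun j hj => by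
    by_cases h : j = i
    · exact Or.inl h
    · exact Or.inr ⟨hj.1, fun h' => hj.2 ⟨h', h⟩⟩

/-- The Dirac sea `{-1, -2, …}`. -/
def vac : Maya where
  occ := {i | i < 0}
  finite_particles := by
    convert Set.finite_empty (α := ℤ)
    ext i
    simp
  finite_holes := by
    convert Set.finite_empty (α := ℤ)
    ext i
    simp

/-- The sign `(-1)^{#{ℓ ∈ S : ℓ > i}}` from moving `e_i` to its place in a decreasing wedge. -/
noncomputable def sgn (S : Maya) (i : ℤ) : ℂ := (-1) ^ {l | l ∈ S.occ ∧ i < l}.ncard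

end Maya

/-- The fermionic Fock space, completed so that arbitrary infinite combinations
`∑_S v_S e_S` of basis elements are allowed. -/
abbrev Fock : Type := Maya → ℂ

open Classical in
/-- `ψ_i = e_i ∧`. -/
noncomputable def psi (i : ℤ) : Module.End ℂ Fock where
  toFun v S := if i ∈ S.occ then S.sgn i * v (S.clear i) else 0
  map_add' v w := by
    ext S
    by_cases h : i ∈ S.occ <;> simp [h, mul_add]
  map_smul' c v := by
    ext S
    by_cases h : i ∈ S.occ <;> simp [h, mul_left_comm]

open Classical in
/-- `ψ*_i`, interior multiplication by the dual basis element of `e_i`. -/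
noncomputable def psiStar (i : ℤ) : Module.End ℂ Fock where
  toFun v S := if i ∈ S.occ then 0 else S.sgn i * v (S.fill i)
  map_add' v w := by
    ext S
    by_cases h : i ∈ S.occ <;> simp [h, mul_add]
  map_smul' c v := by
    ext S
    by_cases h : i ∈ S.occ <;> simp [h, mul_left_comm]

/-- The coefficient of `zⁿ` in `ψ(z) = ∑ᵢ ψ_i zⁱ`. -/
noncomputable def psiField (n : ℤ) : Module.End ℂ Fock := psi n

/-- The coefficient of `zⁿ` in `ψ*(z) = ∑ᵢ ψ*_i z^{-i-1}`. -/
noncomputable def psiStarField (n : ℤ) : Module.End ℂ Fock := psiStar (-n - 1)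

open Classical in
/-- The vacuum vector `|0⟩ = e_{-1} ∧ e_{-2} ∧ ⋯`. -/
noncomputable def vacuum : Fock := Pi.single Maya.vac 1

/-- The vacuum expectation value `⟨0| X |0⟩`. -/
noncomputable def vev (X : Module.End ℂ Fock) : ℂ := X vacuum Maya.vac

/-- The formal series `⟨0| L Φ(z) R |0⟩` for a formal series `Φ(z)` of operators. -/
noncomputable def vevSeries (L : Module.End ℂ Fock) (Φ : ℤ → Module.End ℂ Fock)
    (R : Module.End ℂ Fock) : FormalSeries := fun n => vev (L * Φ n * R)

/-- The normal ordered product `:ψ_i ψ*_j:` (for `i < 0` the operator `ψ_i` kills the vacuum and is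
moved to the right). -/
noncomputable def normalOrd (i j : ℤ) : Module.End ℂ Fock :=
  if i < 0 then -(psiStar j * psi i) else psi i * psiStar j

theorem LowerTri.finite_support_normalOrd (A : LowerTri) (v : Fock) (S : Maya) :
    (Function.support fun p : ℤ × ℤ => A.entry p.1 p.2 * normalOrd p.1 p.2 v S).Finite := by
  have hP : ((⋃ i ∈ {i | 0 ≤ i ∧ i ∈ S.occ},
      ({i} : Set ℤ) ×ˢ ({j | j < 0 ∧ j ∉ S.occ} ∪ Set.Icc 0 i)) ∪
      ⋃ j ∈ {j | j < 0 ∧ j ∉ S.occ}, (Set.Icc j 0) ×ˢ ({j} : Set ℤ)).Finite := by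
    refine Set.Finite.union ?_ ?_
    · exact S.finite_particles.biUnion fun i _ =>
        (Set.finite_singleton i).prod (S.finite_holes.union (Set.finite_Icc 0 i))
    · exact S.finite_holes.biUnion fun j _ =>
        (Set.finite_Icc j 0).prod (Set.finite_singleton j)
  refine hP.subset ?_
  rintro ⟨i, j⟩ hp
  rw [Function.mem_support] at hp
  have hji : j ≤ i := by
    by_contra h
    exact hp (by rw [A.entry_eq_zero (not_le.mp h), zero_mul])
  have hn : normalOrd i j v S ≠ 0 := right_ne_zero_of_mul hp
  unfold normalOrd at hn
  by_cases hi : i < 0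
  · right
    have hj : j ∉ S.occ := by
      intro h
      apply hn
      simp [hi, psiStar, h]
    simp only [Set.mem_iUnion]
    exact ⟨j, ⟨lt_of_le_of_lt hji hi, hj⟩, ⟨hji, hi.le⟩, rfl⟩
  · left
    have hiS : i ∈ S.occ := by
      by_contra h
      apply hn
      simp [hi, psi, h]
    have hj : j ∉ (S.clear i).occ := by
      intro h
      apply hn
      simp [hi, psi, psiStar, h]
    simp only [Set.mem_iUnion]
    refine ⟨i, ⟨not_lt.mp hi, hiS⟩, rfl, ?_⟩
    by_cases h0 : j < 0
    · left
      exact ⟨h0, fun h => hj ⟨h, fun h' => hi (by rw [← show j = i from h']; exact h0)⟩⟩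
    · right
      exact ⟨not_lt.mp h0, hji⟩

/-- The operator `∑_{i,j} A_{ij} :ψ_i ψ*_j:` on Fock space; each component of its value is a finite
sum. -/
noncomputable def LowerTri.clifford (A : LowerTri) : Module.End ℂ Fock where
  toFun v S := ∑ᶠ p : ℤ × ℤ, A.entry p.1 p.2 * normalOrd p.1 p.2 v S
  map_add' v w := by
    ext S
    change _ = (∑ᶠ p : ℤ × ℤ, A.entry p.1 p.2 * normalOrd p.1 p.2 v S) +
      ∑ᶠ p : ℤ × ℤ, A.entry p.1 p.2 * normalOrd p.1 p.2 w S
    rw [← finsum_add_distrib (A.finite_support_normalOrd v S) (A.finite_support_normalOrd w S)]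
    exact finsum_congr fun p => by simp [mul_add]
  map_smul' c v := by
    ext S
    change _ = c * ∑ᶠ p : ℤ × ℤ, A.entry p.1 p.2 * normalOrd p.1 p.2 v S
    rw [mul_finsum' _ _ (A.finite_support_normalOrd v S)]
    exact finsum_congr fun p => by simp [mul_left_comm]

/-- `G = exp X` on Fock space, i.e. `G v = ∑ₙ Xⁿ v / n!` with componentwise convergence. -/
def IsFockExp (X G : Module.End ℂ Fock) : Prop :=
  ∀ (v : Fock) (S : Maya), HasSum (fun n : ℕ => ((n ! : ℂ))⁻¹ * (X ^ n) v S) (G v S)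

/-!
On components the operator `∑ A_{ij} :ψ_i ψ*_j:` is row finite in a strong sense. Let the window
`Maya.window N` be the finite set of basis elements whose sites above `N` are empty and whose sites
below `-N` are occupied. Since `A` is lower triangular, `:ψ_i ψ*_j:` only moves particles upwards,
so the components of `X v` in the window depend only on those of `v` in the window, and only the
entries `A_{ij}` with `-N ≤ i, j ≤ N` enter (`LowerTri.clifford_apply_of_mem_window`). The
operators `ψ_i`, `ψ*_i` with `|i| ≤ N` have the same stability (`StableOn`). Taking the block of an
operator in a window is multiplicative on stable operators, and every basis element lies in a
window, so all identities may be checked between finite matrices. In particular the exponential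
converges and is invertible because matrix exponentials are (`exists_unit_isFockExp`).

By the canonical anticommutation relations, the commutator of `∑ⱼ B_{ij} ψ*_j` with the operator is
`∑ⱼ (B A)_{ij} ψ*_j`, and that of `∑ᵢ B_{ij} ψ_i` is `-∑ᵢ (A B)_{ij} ψ_i`. In a Banach algebra, if
`P_l M = M P_l + P_{l+1}` for all `l`, then `P_0 e^M = e^M ∑ₗ P_l / l!`, by the binomial expansion
of `P_0 Mⁿ` and a Cauchy product (`mul_exp_eq_exp_mul_of_shift`). Applied in a window, with `M` the
block of the operator or of its negative, this gives `ĝ⁻¹ ψ*_i ĝ = ∑ⱼ g_{ij} ψ*_j` and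
`ĝ⁻¹ ψ_j ĝ = ∑ᵢ (g⁻¹)_{ij} ψ_i`. The vacuum expectation values of `ψ_j ψ*_i` and `ψ*_i ψ_j` then
pick out the single matrix entry which is the coefficient of the adapted basis.
-/

/-! ### Intertwining relations and exponentials -/

theorem mul_pow_eq_sum_antidiagonal_of_shift {R : Type*} [Ring R] {M : R} {P : ℕ → R}
    (hP : ∀ l, P l * M = M * P l + P (l + 1)) (n l : ℕ) :
    P l * M ^ n =
      ∑ p ∈ Finset.HasAntidiagonal.antidiagonal n, n.choose p.1 • (M ^ p.1 * P (l + p.2)) := by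
  induction n generalizing l with
  | zero => simp
  | succ n ih =>
    rw [Finset.sum_antidiagonal_choose_succ_nsmul (fun a b => M ^ a * P (l + b)) n,
      pow_succ', ← mul_assoc, hP, add_mul, mul_assoc, ih, ih, Finset.mul_sum, add_comm]
    congr 1
    · refine Finset.sum_congr rfl fun p _ => ?_
      rw [show l + 1 + p.2 = l + (p.2 + 1) by omega]
    · refine Finset.sum_congr rfl fun p hp => ?_
      rw [mul_smul_comm, pow_succ', mul_assoc, Nat.choose_symm_of_eq_add]
      rw [Finset.HasAntidiagonal.mem_antidiagonal] at hp
      omega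

/-- If commuting with `M` shifts the sequence `P`, then conjugating `P 0` by `exp M` produces
`∑ₗ P l / l!`. -/
theorem mul_exp_eq_exp_mul_of_shift {R : Type*} [NormedRing R] [NormedAlgebra ℂ R]
    [CompleteSpace R] {M Q : R} {P : ℕ → R} (hP : ∀ l, P l * M = M * P l + P (l + 1))
    (hs : Summable fun l : ℕ => ‖((l ! : ℂ))⁻¹ • P l‖)
    (hQ : HasSum (fun l : ℕ => ((l ! : ℂ))⁻¹ • P l) Q) :
    P 0 * NormedSpace.exp M = NormedSpace.exp M * Q := by
  have hM := NormedSpace.exp_series_hasSum_exp' (𝕂 := ℂ) M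
  rw [← (hM.mul_left (P 0)).tsum_eq, ← hM.tsum_eq, ← hQ.tsum_eq,
    tsum_mul_tsum_eq_tsum_sum_antidiagonal_of_summable_norm
      (NormedSpace.norm_expSeries_summable' (𝕂 := ℂ) M) hs]
  refine tsum_congr fun n => ?_
  rw [mul_smul_comm, mul_pow_eq_sum_antidiagonal_of_shift hP, Finset.smul_sum]
  refine Finset.sum_congr rfl fun p hp => ?_
  rw [Finset.HasAntidiagonal.mem_antidiagonal] at hp
  subst hp
  rw [zero_add, smul_mul_smul_comm, ← Nat.cast_smul_eq_nsmul ℂ, smul_smul]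
  congr 1
  have h1 : (p.1 ! : ℂ) ≠ 0 := Nat.cast_ne_zero.mpr (Nat.factorial_ne_zero _)
  have h2 : (p.2 ! : ℂ) ≠ 0 := Nat.cast_ne_zero.mpr (Nat.factorial_ne_zero _)
  have h3 : ((p.1 + p.2)! : ℂ) ≠ 0 := Nat.cast_ne_zero.mpr (Nat.factorial_ne_zero _)
  have h4 : ((p.1 + p.2).choose p.1 : ℂ) * p.1 ! * p.2 ! = (p.1 + p.2)! := by
    have := Nat.choose_mul_factorial_mul_factorial (Nat.le_add_right p.1 p.2)
    rw [Nat.add_sub_cancel_left] at this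
    exact_mod_cast this
  rw [inv_mul_eq_iff_eq_mul₀ h3, ← h4]
  field_simp

/-! ### Operators that descend to finitely many components -/

section Block

variable {ι : Type*}

/-- The components in `F` of `X v` depend only on the components in `F` of `v`. -/
def StableOn (F : Finset ι) (X : Module.End ℂ (ι → ℂ)) : Prop :=
  ∀ v : ι → ℂ, (∀ s ∈ F, v s = 0) → ∀ s ∈ F, X v s = 0

namespace StableOn

variable {F : Finset ι} {X Y : Module.End ℂ (ι → ℂ)}

theorem mul (hX : StableOn F X) (hY : StableOn F Y) : StableOn F (X * Y) :=
  fun v hv => hX _ (hY v hv)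

theorem one : StableOn F (1 : Module.End ℂ (ι → ℂ)) := fun _ hv => hv

theorem neg (hX : StableOn F X) : StableOn F (-X) := fun v hv s hs => by
  simp [hX v hv s hs]

theorem smul (c : ℂ) (hX : StableOn F X) : StableOn F (c • X) := fun v hv s hs => by
  simp [hX v hv s hs]

theorem sum {κ : Type*} {J : Finset κ} {Z : κ → Module.End ℂ (ι → ℂ)}
    (hZ : ∀ k ∈ J, StableOn F (Z k)) : StableOn F (∑ k ∈ J, Z k) := fun v hv s hs => by
  rw [LinearMap.sum_apply, Finset.sum_apply]
  exact Finset.sum_eq_zero fun k hk => hZ k hk v hv s hs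

theorem pow (hX : StableOn F X) (n : ℕ) : StableOn F (X ^ n) := by
  induction n with
  | zero => exact one
  | succ n ih => rw [pow_succ]; exact ih.mul hX

end StableOn

variable [DecidableEq ι]

/-- The `F × F` block of the matrix of `X`. It describes `X` on the components in `F` when `X` is
stable on `F`. -/
noncomputable def block (F : Finset ι) : Module.End ℂ (ι → ℂ) →ₗ[ℂ] Matrix F F ℂ where
  toFun X := Matrix.of fun s t => X (Pi.single (t : ι) 1) s
  map_add' X Y := by ext; simp
  map_smul' c X := by ext; simp

theorem block_apply (F : Finset ι) (X : Module.End ℂ (ι → ℂ)) (s t : F) :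
    block F X s t = X (Pi.single (t : ι) 1) s := rfl

theorem block_one (F : Finset ι) : block F 1 = 1 := by
  ext s t
  simp [block_apply, Matrix.one_apply, Pi.single_apply]

theorem StableOn.apply_eq_mulVec {F : Finset ι} {X : Module.End ℂ (ι → ℂ)} (hX : StableOn F X)
    (v : ι → ℂ) (s : F) : X v s = (block F X).mulVec (fun t => v t) s := by
  have h := hX (v - ∑ t : F, v t • Pi.single (t : ι) (1 : ℂ)) (fun s hs => by
    rw [Pi.sub_apply, Finset.sum_apply, Finset.sum_eq_single ⟨s, hs⟩]
    · simp
    · intro t _ ht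
      have : s ≠ t := fun h => ht (Subtype.ext h.symm)
      simp [this]
    · simp) s s.2
  rw [map_sub, Pi.sub_apply, sub_eq_zero] at h
  rw [h, map_sum, Finset.sum_apply, Matrix.mulVec, dotProduct]
  exact Finset.sum_congr rfl fun t _ => by simp [block_apply, mul_comm]

theorem StableOn.block_mul {F : Finset ι} {X : Module.End ℂ (ι → ℂ)} (hX : StableOn F X)
    (Y : Module.End ℂ (ι → ℂ)) : block F (X * Y) = block F X * block F Y := by
  ext s t
  rw [block_apply, Module.End.mul_apply, hX.apply_eq_mulVec]
  rfl

theorem StableOn.block_pow {F : Finset ι} {X : Module.End ℂ (ι → ℂ)} (hX : StableOn F X)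
    (n : ℕ) : block F (X ^ n) = block F X ^ n := by
  induction n with
  | zero => exact block_one F
  | succ n ih => rw [pow_succ, (hX.pow n).block_mul, ih, pow_succ]

theorem StableOn.apply_congr {F : Finset ι} {X Y : Module.End ℂ (ι → ℂ)} (hX : StableOn F X)
    (hY : StableOn F Y) (h : block F X = block F Y) (v : ι → ℂ) {s : ι} (hs : s ∈ F) :
    X v s = Y v s := by
  rw [hX.apply_eq_mulVec v ⟨s, hs⟩, hY.apply_eq_mulVec v ⟨s, hs⟩, h]

open scoped Matrix.Norms.Operator in
theorem hasSum_exp_apply (M : Matrix ι ι ℂ) [Fintype ι] (s t : ι) :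
    HasSum (fun n : ℕ => ((n ! : ℂ))⁻¹ * (M ^ n) s t) (NormedSpace.exp M s t) :=
  Pi.hasSum.mp (Pi.hasSum.mp (NormedSpace.exp_series_hasSum_exp' (𝕂 := ℂ) M) s) t

theorem StableOn.hasSum_exp {F : Finset ι} {X : Module.End ℂ (ι → ℂ)} (hX : StableOn F X)
    (v : ι → ℂ) (s : F) :
    HasSum (fun n : ℕ => ((n ! : ℂ))⁻¹ * (X ^ n) v s)
      ((NormedSpace.exp (block F X)).mulVec (fun t => v t) s) := by
  have h : ∀ n : ℕ, ((n ! : ℂ))⁻¹ * (X ^ n) v s =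
      ∑ t : F, (((n ! : ℂ))⁻¹ * (block F X ^ n) s t) * v t := fun n => by
    rw [(hX.pow n).apply_eq_mulVec, hX.block_pow, Matrix.mulVec, dotProduct, Finset.mul_sum]
    exact Finset.sum_congr rfl fun t _ => (mul_assoc _ _ _).symm
  simp_rw [h]
  exact hasSum_sum fun t _ => (hasSum_exp_apply _ s t).mul_right _

open scoped Matrix.Norms.Operator in
/-- The version of `mul_exp_eq_exp_mul_of_shift` for matrices, with entrywise convergence. -/
theorem Matrix.mul_exp_eq_exp_mul_of_shift [Fintype ι] {M Q : Matrix ι ι ℂ}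
    {P : ℕ → Matrix ι ι ℂ} (hP : ∀ l, P l * M = M * P l + P (l + 1))
    (hQ : ∀ s t, HasSum (fun l : ℕ => ((l ! : ℂ))⁻¹ * P l s t) (Q s t)) :
    P 0 * NormedSpace.exp M = NormedSpace.exp M * Q := by
  have h : HasSum (fun l : ℕ => ((l ! : ℂ))⁻¹ • P l) Q :=
    Pi.hasSum.mpr fun s => Pi.hasSum.mpr fun t => hQ s t
  have : FiniteDimensional ℝ (Matrix ι ι ℂ) := Module.Finite.trans ℂ _
  exact _root_.mul_exp_eq_exp_mul_of_shift hP h.summable.norm h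

theorem Matrix.exp_neg_mul_exp [Fintype ι] (M : Matrix ι ι ℂ) :
    NormedSpace.exp (-M) * NormedSpace.exp M = 1 := by
  rw [← Matrix.exp_add_of_commute _ _ (Commute.refl M).neg_left, neg_add_cancel,
    NormedSpace.exp_zero]

end Block

/-! ### Exponentials of operators on Fock space -/

theorem IsFockExp.stableOn {X G : Module.End ℂ Fock} (hG : IsFockExp X G) {F : Finset Maya}
    (hX : StableOn F X) : StableOn F G := fun v hv s hs => by
  refine (hG v s).unique ?_
  simp_rw [hX.pow _ v hv s hs, mul_zero]
  exact hasSum_zero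

theorem IsFockExp.block_eq [DecidableEq Maya] {X G : Module.End ℂ Fock} (hG : IsFockExp X G)
    {F : Finset Maya} (hX : StableOn F X) : block F G = NormedSpace.exp (block F X) := by
  ext s t
  rw [block_apply, (hG _ s).unique (hX.hasSum_exp _ s)]
  simp [Matrix.mulVec, dotProduct, Pi.single_apply]

/-- An operator that is stable on a family of finite sets covering all basis elements has an
exponential. -/
theorem exists_isFockExp {X : Module.End ℂ Fock}
    (hX : ∀ S : Maya, ∃ F : Finset Maya, S ∈ F ∧ StableOn F X) :
    ∃ G : Module.End ℂ Fock, IsFockExp X G := by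
  classical
  have hs : ∀ (v : Fock) (S : Maya), Summable fun n : ℕ => ((n ! : ℂ))⁻¹ * (X ^ n) v S := by
    intro v S
    obtain ⟨F, hS, hF⟩ := hX S
    exact (hF.hasSum_exp v ⟨S, hS⟩).summable
  refine ⟨{ toFun := fun v S => ∑' n : ℕ, ((n ! : ℂ))⁻¹ * (X ^ n) v S
            map_add' := fun v w => ?_
            map_smul' := fun c v => ?_ }, fun v S => (hs v S).hasSum⟩
  · ext S
    rw [Pi.add_apply, ← (hs v S).tsum_add (hs w S)]
    exact tsum_congr fun n => by simp [mul_add]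
  · ext S
    rw [Pi.smul_apply, smul_eq_mul, RingHom.id_apply, ← tsum_mul_left]
    exact tsum_congr fun n => by simp [mul_left_comm]

theorem IsFockExp.mul_eq_one {X G H : Module.End ℂ Fock}
    (hX : ∀ S : Maya, ∃ F : Finset Maya, S ∈ F ∧ StableOn F X)
    (hG : IsFockExp X G) (hH : IsFockExp (-X) H) : H * G = 1 := by
  classical
  refine LinearMap.ext fun v => funext fun S => ?_
  obtain ⟨F, hS, hF⟩ := hX S
  have hH' := hH.stableOn hF.neg
  refine (hH'.mul (hG.stableOn hF)).apply_congr StableOn.one ?_ v hS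
  rw [hH'.block_mul, hH.block_eq hF.neg, hG.block_eq hF, map_neg, Matrix.exp_neg_mul_exp,
    block_one]

/-- The exponential is invertible, with inverse the exponential of `-X`. -/
theorem exists_unit_isFockExp {X : Module.End ℂ Fock}
    (hX : ∀ S : Maya, ∃ F : Finset Maya, S ∈ F ∧ StableOn F X) :
    ∃ G : (Module.End ℂ Fock)ˣ, IsFockExp X (G : Module.End ℂ Fock) ∧
      IsFockExp (-X) (↑G⁻¹ : Module.End ℂ Fock) := by
  have hX' : ∀ S : Maya, ∃ F : Finset Maya, S ∈ F ∧ StableOn F (-X) := fun S => by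
    obtain ⟨F, hS, hF⟩ := hX S
    exact ⟨F, hS, hF.neg⟩
  obtain ⟨G, hG⟩ := exists_isFockExp hX
  obtain ⟨H, hH⟩ := exists_isFockExp hX'
  have hGH : G * H = 1 := IsFockExp.mul_eq_one hX' hH (by rwa [neg_neg])
  exact ⟨⟨G, H, hGH, IsFockExp.mul_eq_one hX hG hH⟩, hG, hH⟩

/-! ### Canonical anticommutation relations -/

namespace Maya

theorem mem_fill {S : Maya} {i l : ℤ} : l ∈ (S.fill i).occ ↔ l = i ∨ l ∈ S.occ := Iff.rfl

theorem mem_clear {S : Maya} {i l : ℤ} : l ∈ (S.clear i).occ ↔ l ∈ S.occ ∧ l ≠ i := Iff.rfl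

theorem mem_vac {l : ℤ} : l ∈ vac.occ ↔ l < 0 := Iff.rfl

theorem ext_mem {S T : Maya} (h : ∀ l, l ∈ S.occ ↔ l ∈ T.occ) : S = T :=
  Maya.ext (Set.ext h)

theorem clear_clear_comm (S : Maya) (i j : ℤ) : (S.clear i).clear j = (S.clear j).clear i :=
  ext_mem fun l => by simp only [mem_clear]; tauto

theorem fill_fill_comm (S : Maya) (i j : ℤ) : (S.fill i).fill j = (S.fill j).fill i :=
  ext_mem fun l => by simp only [mem_fill]; tauto

theorem clear_fill_comm (S : Maya) {i j : ℤ} (h : i ≠ j) :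
    (S.clear i).fill j = (S.fill j).clear i :=
  ext_mem fun l => by
    simp only [mem_fill, mem_clear]
    constructor
    · rintro (rfl | ⟨h1, h2⟩)
      exacts [⟨Or.inl rfl, h.symm⟩, ⟨Or.inr h1, h2⟩]
    · rintro ⟨h1 | h1, h2⟩
      exacts [Or.inl h1, Or.inr ⟨h1, h2⟩]

theorem fill_clear_self {S : Maya} {i : ℤ} (h : i ∈ S.occ) : (S.clear i).fill i = S :=
  ext_mem fun l => by
    simp only [mem_fill, mem_clear]
    by_cases hl : l = i
    · simp [hl, h]
    · simp [hl]

theorem clear_fill_self {S : Maya} {i : ℤ} (h : i ∉ S.occ) : (S.fill i).clear i = S :=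
  ext_mem fun l => by
    simp only [mem_fill, mem_clear]
    by_cases hl : l = i
    · simp [hl, h]
    · simp [hl]

theorem finite_gt (S : Maya) (i : ℤ) : {l | l ∈ S.occ ∧ i < l}.Finite :=
  (S.finite_particles.union (Set.finite_Icc i 0)).subset fun l hl => by
    rcases le_or_gt 0 l with h | h
    · exact Or.inl ⟨h, hl.1⟩
    · exact Or.inr ⟨hl.2.le, h.le⟩

theorem sgn_mul_self (S : Maya) (i : ℤ) : S.sgn i * S.sgn i = 1 := by
  rw [sgn, ← mul_pow]
  simp

theorem sgn_clear_of_le (S : Maya) {i j : ℤ} (h : i ≤ j) : (S.clear i).sgn j = S.sgn j := by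
  unfold sgn
  congr 2
  ext l
  simp only [Set.mem_ofPred_eq, mem_clear]
  exact ⟨fun hl => ⟨hl.1.1, hl.2⟩, fun hl => ⟨⟨hl.1, (h.trans_lt hl.2).ne'⟩, hl.2⟩⟩

theorem sgn_fill_of_le (S : Maya) {i j : ℤ} (h : i ≤ j) : (S.fill i).sgn j = S.sgn j := by
  unfold sgn
  congr 2
  ext l
  simp only [Set.mem_ofPred_eq, mem_fill]
  exact ⟨fun hl => ⟨hl.1.resolve_left (h.trans_lt hl.2).ne', hl.2⟩, fun hl => ⟨Or.inr hl.1, hl.2⟩⟩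

theorem sgn_fill_of_lt {S : Maya} {i j : ℤ} (h : j < i) (hi : i ∉ S.occ) :
    (S.fill i).sgn j = -S.sgn j := by
  have : {l | l ∈ (S.fill i).occ ∧ j < l} = insert i {l | l ∈ S.occ ∧ j < l} := by
    ext l
    simp only [Set.mem_ofPred_eq, mem_fill, Set.mem_insert_iff]
    constructor
    · rintro ⟨h1 | h1, h2⟩
      exacts [Or.inl h1, Or.inr ⟨h1, h2⟩]
    · rintro (rfl | h1)
      exacts [⟨Or.inl rfl, h⟩, ⟨Or.inr h1.1, h1.2⟩]
  unfold sgn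
  rw [this, Set.ncard_insert_of_notMem (fun h' => hi h'.1) (S.finite_gt j), pow_succ]
  simp

theorem sgn_clear_of_lt {S : Maya} {i j : ℤ} (h : j < i) (hi : i ∈ S.occ) :
    (S.clear i).sgn j = -S.sgn j := by
  have := sgn_fill_of_lt h (S := S.clear i) fun h' => h'.2 rfl
  rw [fill_clear_self hi] at this
  rw [this, neg_neg]

end Maya

theorem psi_apply_of_mem {i : ℤ} {S : Maya} (h : i ∈ S.occ) (v : Fock) :
    psi i v S = S.sgn i * v (S.clear i) := if_pos h

theorem psi_apply_of_notMem {i : ℤ} {S : Maya} (h : i ∉ S.occ) (v : Fock) :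
    psi i v S = 0 := if_neg h

theorem psiStar_apply_of_mem {i : ℤ} {S : Maya} (h : i ∈ S.occ) (v : Fock) :
    psiStar i v S = 0 := if_pos h

theorem psiStar_apply_of_notMem {i : ℤ} {S : Maya} (h : i ∉ S.occ) (v : Fock) :
    psiStar i v S = S.sgn i * v (S.fill i) := if_neg h

theorem psi_mul_psi (i j : ℤ) : psi i * psi j = -(psi j * psi i) := by
  wlog hij : i ≤ j generalizing i j
  · rw [this j i (not_le.mp hij).le, neg_neg]
  refine LinearMap.ext fun v => funext fun S => ?_
  rw [LinearMap.neg_apply, Pi.neg_apply, Module.End.mul_apply, Module.End.mul_apply]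
  rcases hij.eq_or_lt with rfl | hij
  · have : psi i (psi i v) S = 0 := by
      by_cases hi : i ∈ S.occ
      · rw [psi_apply_of_mem hi, psi_apply_of_notMem (fun h => (Maya.mem_clear.mp h).2 rfl),
          mul_zero]
      · exact psi_apply_of_notMem hi _
    rw [this, neg_zero]
  · by_cases hi : i ∈ S.occ
    · by_cases hj : j ∈ S.occ
      · rw [psi_apply_of_mem hi, psi_apply_of_mem hj,
          psi_apply_of_mem (Maya.mem_clear.mpr ⟨hj, hij.ne'⟩),
          psi_apply_of_mem (Maya.mem_clear.mpr ⟨hi, hij.ne⟩), S.sgn_clear_of_le hij.le,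
          Maya.sgn_clear_of_lt hij hj, S.clear_clear_comm i j]
        ring
      · rw [psi_apply_of_mem hi, psi_apply_of_notMem hj,
          psi_apply_of_notMem fun h => hj (Maya.mem_clear.mp h).1]
        simp
    · rw [psi_apply_of_notMem hi]
      by_cases hj : j ∈ S.occ
      · rw [psi_apply_of_mem hj, psi_apply_of_notMem fun h => hi (Maya.mem_clear.mp h).1]
        simp
      · rw [psi_apply_of_notMem hj, neg_zero]

theorem psiStar_mul_psiStar (i j : ℤ) : psiStar i * psiStar j = -(psiStar j * psiStar i) := by
  wlog hij : i ≤ j generalizing i j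
  · rw [this j i (not_le.mp hij).le, neg_neg]
  refine LinearMap.ext fun v => funext fun S => ?_
  rw [LinearMap.neg_apply, Pi.neg_apply, Module.End.mul_apply, Module.End.mul_apply]
  rcases hij.eq_or_lt with rfl | hij
  · have : psiStar i (psiStar i v) S = 0 := by
      by_cases hi : i ∈ S.occ
      · exact psiStar_apply_of_mem hi _
      · rw [psiStar_apply_of_notMem hi, psiStar_apply_of_mem (Or.inl rfl), mul_zero]
    rw [this, neg_zero]
  · by_cases hi : i ∈ S.occ
    · rw [psiStar_apply_of_mem hi]
      by_cases hj : j ∈ S.occ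
      · rw [psiStar_apply_of_mem hj, neg_zero]
      · rw [psiStar_apply_of_notMem hj, psiStar_apply_of_mem (Or.inr hi)]
        simp
    · by_cases hj : j ∈ S.occ
      · rw [psiStar_apply_of_notMem hi, psiStar_apply_of_mem hj, psiStar_apply_of_mem (Or.inr hj)]
        simp
      · rw [psiStar_apply_of_notMem hi, psiStar_apply_of_notMem hj,
          psiStar_apply_of_notMem (fun h => (Maya.mem_fill.mp h).elim hij.ne' hj),
          psiStar_apply_of_notMem (fun h => (Maya.mem_fill.mp h).elim hij.ne hi),
          S.sgn_fill_of_le hij.le, Maya.sgn_fill_of_lt hij hj, S.fill_fill_comm i j]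
        ring

theorem psiStar_mul_psi (i j : ℤ) :
    psiStar i * psi j = (if i = j then 1 else 0) - psi j * psiStar i := by
  refine LinearMap.ext fun v => funext fun S => ?_
  rw [LinearMap.sub_apply, Pi.sub_apply, Module.End.mul_apply, Module.End.mul_apply]
  split_ifs with hij
  · subst hij
    rw [Module.End.one_apply]
    by_cases hi : i ∈ S.occ
    · rw [psiStar_apply_of_mem hi, psi_apply_of_mem hi,
        psiStar_apply_of_notMem (fun h => (Maya.mem_clear.mp h).2 rfl), S.sgn_clear_of_le le_rfl,
        ← mul_assoc, S.sgn_mul_self, Maya.fill_clear_self hi]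
      ring
    · rw [psi_apply_of_notMem hi, psiStar_apply_of_notMem hi, psi_apply_of_mem (Or.inl rfl),
        S.sgn_fill_of_le le_rfl, ← mul_assoc, S.sgn_mul_self, Maya.clear_fill_self hi]
      ring
  · rw [LinearMap.zero_apply, Pi.zero_apply, zero_sub]
    by_cases hi : i ∈ S.occ
    · rw [psiStar_apply_of_mem hi]
      by_cases hj : j ∈ S.occ
      · rw [psi_apply_of_mem hj, psiStar_apply_of_mem (Maya.mem_clear.mpr ⟨hi, hij⟩)]
        simp
      · rw [psi_apply_of_notMem hj, neg_zero]
    · rw [psiStar_apply_of_notMem hi]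
      by_cases hj : j ∈ S.occ
      · rw [psi_apply_of_mem (Or.inr hj), psi_apply_of_mem hj,
          psiStar_apply_of_notMem (fun h => hi (Maya.mem_clear.mp h).1),
          S.clear_fill_comm (Ne.symm hij)]
        rcases lt_or_gt_of_ne hij with h | h
        · rw [S.sgn_fill_of_le h.le, Maya.sgn_clear_of_lt h hj]
          ring
        · rw [S.sgn_clear_of_le h.le, Maya.sgn_fill_of_lt h hi]
          ring
      · rw [psi_apply_of_notMem hj,
          psi_apply_of_notMem (fun h => (Maya.mem_fill.mp h).elim (Ne.symm hij) hj)]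
        simp

theorem normalOrd_eq (a b : ℤ) :
    normalOrd a b = psi a * psiStar b - if a = b ∧ a < 0 then 1 else 0 := by
  unfold normalOrd
  by_cases ha : a < 0
  · rw [if_pos ha, psiStar_mul_psi]
    by_cases hab : a = b
    · subst hab
      simp [ha]
    · simp [hab, Ne.symm hab]
  · simp [ha]

theorem mul_mul_of_anticommute_right {R : Type*} [Ring R] {s x y c : R}
    (hx : s * x = c - x * s) (hy : s * y = -(y * s)) : s * (x * y) = x * y * s + c * y := by
  rw [← mul_assoc, hx, sub_mul, mul_assoc x s y, hy, mul_neg, ← mul_assoc]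
  abel

theorem mul_mul_of_anticommute_left {R : Type*} [Ring R] {s x y c : R}
    (hx : s * x = -(x * s)) (hy : y * s = c - s * y) : s * (x * y) = x * y * s - x * c := by
  rw [← mul_assoc, hx, neg_mul, mul_assoc, mul_assoc x y s, hy, mul_sub]
  abel

theorem psiStar_mul_normalOrd (i a b : ℤ) :
    psiStar i * normalOrd a b = normalOrd a b * psiStar i + if i = a then psiStar b else 0 := by
  have h := mul_mul_of_anticommute_right (psiStar_mul_psi i a) (psiStar_mul_psiStar i b)
  rw [ite_mul, one_mul, zero_mul] at h
  rw [normalOrd_eq, mul_sub, sub_mul, h]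
  simp only [ite_mul, mul_ite, mul_one, one_mul, mul_zero, zero_mul]
  abel

theorem psi_mul_normalOrd (j a b : ℤ) :
    psi j * normalOrd a b = normalOrd a b * psi j - if b = j then psi a else 0 := by
  have h := mul_mul_of_anticommute_left (psi_mul_psi j a) (psiStar_mul_psi b j)
  rw [mul_ite, mul_one, mul_zero] at h
  rw [normalOrd_eq, mul_sub, sub_mul, h]
  simp only [ite_mul, mul_ite, mul_one, one_mul, mul_zero, zero_mul]
  abel

/-! ### Vacuum expectation values of quadratic monomials -/

theorem vacuum_apply_self : vacuum Maya.vac = 1 := by simp [vacuum]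

theorem vev_add (X Y : Module.End ℂ Fock) : vev (X + Y) = vev X + vev Y := rfl

theorem vev_mul_psi_of_neg (X : Module.End ℂ Fock) {i : ℤ} (hi : i < 0) :
    vev (X * psi i) = 0 := by
  have : psi i vacuum = 0 := by
    funext S
    by_cases h : i ∈ S.occ
    · rw [psi_apply_of_mem h]
      have : S.clear i ≠ Maya.vac := fun h' => by
        have h2 : i ∈ (S.clear i).occ := h' ▸ Maya.mem_vac.mpr hi
        exact h2.2 rfl
      simp [vacuum, this]
    · exact psi_apply_of_notMem h _
  rw [vev, Module.End.mul_apply, this, map_zero, Pi.zero_apply]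

theorem vev_psi_mul_of_nonneg (X : Module.End ℂ Fock) {i : ℤ} (hi : 0 ≤ i) :
    vev (psi i * X) = 0 :=
  psi_apply_of_notMem (fun h => absurd (Maya.mem_vac.mp h) (not_lt.mpr hi)) _

theorem vev_ite_one (p : Prop) [Decidable p] :
    vev (if p then 1 else 0) = if p then 1 else 0 := by
  split_ifs
  · exact vacuum_apply_self
  · rfl

theorem vev_psiStar_mul_psi (i j : ℤ) :
    vev (psiStar i * psi j) = if i = j ∧ 0 ≤ j then 1 else 0 := by
  rcases lt_or_ge j 0 with h | h
  · rw [vev_mul_psi_of_neg _ h, if_neg fun h' => absurd h'.2 (not_le.mpr h)]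
  · have := vev_add (psiStar i * psi j) (psi j * psiStar i)
    rw [vev_psi_mul_of_nonneg _ h, psiStar_mul_psi, sub_add_cancel, vev_ite_one, add_zero] at this
    rw [psiStar_mul_psi, ← this]
    simp [h]

theorem vev_psi_mul_psiStar (i j : ℤ) :
    vev (psi j * psiStar i) = if i = j ∧ j < 0 then 1 else 0 := by
  have := vev_add (psiStar i * psi j) (psi j * psiStar i)
  rw [vev_psiStar_mul_psi, psiStar_mul_psi, sub_add_cancel, vev_ite_one] at this
  by_cases h : i = j <;> by_cases hj : 0 ≤ j <;> simp_all

/-! ### Windows of the Fock space -/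

theorem Maya.finite_window (N : ℤ) :
    {S : Maya | (∀ l ∈ S.occ, l ≤ N) ∧ ∀ l ∉ S.occ, -N ≤ l}.Finite := by
  refine Set.Finite.of_finite_image (f := fun S => S.occ ∩ Set.Icc (-N) N)
    ((Set.finite_Icc (-N) N).finite_subsets.subset ?_) ?_
  · rintro _ ⟨S, -, rfl⟩
    exact Set.inter_subset_right
  · intro S hS T hT h
    refine Maya.ext_mem fun l => ?_
    have hl : l ∈ S.occ ∧ l ∈ Set.Icc (-N) N ↔ l ∈ T.occ ∧ l ∈ Set.Icc (-N) N :=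
      Set.ext_iff.mp h l
    by_cases h1 : l ∈ Set.Icc (-N) N
    · simpa [h1] using hl
    · rw [Set.mem_Icc, not_and_or, not_le, not_le] at h1
      rcases h1 with h1 | h1
      · exact iff_of_true (not_not.mp fun h' => absurd (hS.2 l h') (not_le.mpr h1))
          (not_not.mp fun h' => absurd (hT.2 l h') (not_le.mpr h1))
      · exact iff_of_false (fun h' => absurd (hS.1 l h') (not_le.mpr h1))
          (fun h' => absurd (hT.1 l h') (not_le.mpr h1))

/-- The basis elements in which all sites above `N` are empty and all sites below `-N` are
occupied. -/
noncomputable def Maya.window (N : ℤ) : Finset Maya := (Maya.finite_window N).toFinset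

theorem Maya.mem_window {N : ℤ} {S : Maya} :
    S ∈ window N ↔ (∀ l ∈ S.occ, l ≤ N) ∧ ∀ l ∉ S.occ, -N ≤ l :=
  Set.Finite.mem_toFinset _

theorem Maya.vac_mem_window {N : ℤ} (hN : 0 ≤ N) : vac ∈ window N :=
  mem_window.mpr ⟨fun _ hl => (le_of_lt (mem_vac.mp hl)).trans hN,
    fun _ hl => (neg_nonpos.mpr hN).trans (not_lt.mp fun h => hl (mem_vac.mpr h))⟩

theorem Maya.exists_mem_window (S : Maya) : ∃ N : ℤ, 0 ≤ N ∧ S ∈ window N := by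
  obtain ⟨a, ha⟩ := S.finite_particles.bddAbove
  obtain ⟨b, hb⟩ := S.finite_holes.bddBelow
  refine ⟨max 0 (max a (-b)), le_max_left _ _, mem_window.mpr ⟨fun l hl => ?_, fun l hl => ?_⟩⟩
  · rcases le_or_gt 0 l with h | h
    · have : l ≤ a := ha ⟨h, hl⟩
      omega
    · omega
  · rcases lt_or_ge l 0 with h | h
    · have : b ≤ l := hb ⟨h, hl⟩
      omega
    · omega

theorem Maya.fill_mem_window {N i : ℤ} {S : Maya} (hS : S ∈ window N) (hi : i ≤ N) :
    S.fill i ∈ window N := by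
  rw [mem_window] at hS ⊢
  refine ⟨?_, fun l hl => hS.2 l fun h => hl (Or.inr h)⟩
  rintro l (rfl | hl)
  exacts [hi, hS.1 l hl]

theorem Maya.clear_mem_window {N i : ℤ} {S : Maya} (hS : S ∈ window N) (hi : -N ≤ i) :
    S.clear i ∈ window N := by
  rw [mem_window] at hS ⊢
  refine ⟨fun l hl => hS.1 l hl.1, fun l hl => ?_⟩
  by_cases h : l = i
  · exact h ▸ hi
  · exact hS.2 l fun h' => hl ⟨h', h⟩

theorem stableOn_psi {N i : ℤ} (hi : -N ≤ i) : StableOn (Maya.window N) (psi i) := by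
  intro v hv S hS
  by_cases h : i ∈ S.occ
  · rw [psi_apply_of_mem h, hv _ (Maya.clear_mem_window hS hi), mul_zero]
  · exact psi_apply_of_notMem h v

theorem stableOn_psiStar {N i : ℤ} (hi : i ≤ N) : StableOn (Maya.window N) (psiStar i) := by
  intro v hv S hS
  by_cases h : i ∈ S.occ
  · exact psiStar_apply_of_mem h v
  · rw [psiStar_apply_of_notMem h, hv _ (Maya.fill_mem_window hS hi), mul_zero]

theorem stableOn_normalOrd {N i j : ℤ} (hi : -N ≤ i) (hj : j ≤ N) :
    StableOn (Maya.window N) (normalOrd i j) := by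
  unfold normalOrd
  split_ifs
  · exact ((stableOn_psiStar hj).mul (stableOn_psi hi)).neg
  · exact (stableOn_psi hi).mul (stableOn_psiStar hj)

/-- The part of `∑ A_{ij} :ψ_i ψ*_j:` with `-N ≤ i, j ≤ N`. -/
noncomputable def LowerTri.truncClifford (A : LowerTri) (N : ℤ) : Module.End ℂ Fock :=
  ∑ p ∈ Finset.Icc (-N) N ×ˢ Finset.Icc (-N) N, A.entry p.1 p.2 • normalOrd p.1 p.2

theorem LowerTri.clifford_apply_of_mem_window (A : LowerTri) {N : ℤ} (hN : 0 ≤ N) (v : Fock)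
    {S : Maya} (hS : S ∈ Maya.window N) : A.clifford v S = A.truncClifford N v S := by
  have h : A.clifford v S = ∑ᶠ p : ℤ × ℤ, A.entry p.1 p.2 * normalOrd p.1 p.2 v S := rfl
  rw [h, truncClifford, LinearMap.sum_apply, Finset.sum_apply,
    finsum_eq_sum_of_support_subset (s := Finset.Icc (-N) N ×ˢ Finset.Icc (-N) N)]
  · rfl
  rw [Maya.mem_window] at hS
  rintro ⟨i, j⟩ hp
  rw [Function.mem_support] at hp
  have hji : j ≤ i := not_lt.mp fun h' => hp (by rw [A.entry_eq_zero h', zero_mul])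
  have hn : normalOrd i j v S ≠ 0 := right_ne_zero_of_mul hp
  rw [Finset.mem_coe, Finset.mem_product, Finset.mem_Icc, Finset.mem_Icc]
  unfold normalOrd at hn
  split_ifs at hn with hi
  · have hj : j ∉ S.occ := fun h' => hn (by
      rw [LinearMap.neg_apply, Pi.neg_apply, Module.End.mul_apply, psiStar_apply_of_mem h',
        neg_zero])
    have := hS.2 j hj
    dsimp only
    omega
  · have hiS : i ∈ S.occ := not_not.mp fun h' => hn (psi_apply_of_notMem h' _)
    have hj : j ∉ (S.clear i).occ := fun h' => hn (by
      rw [Module.End.mul_apply, psi_apply_of_mem hiS, psiStar_apply_of_mem h', mul_zero])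
    have h1 := hS.1 i hiS
    have h2 : -N ≤ j := by
      by_cases hij : j = i
      · omega
      · exact hS.2 j fun h' => hj ⟨h', hij⟩
    dsimp only
    omega

theorem LowerTri.stableOn_truncClifford (A : LowerTri) (N : ℤ) :
    StableOn (Maya.window N) (A.truncClifford N) := by
  refine StableOn.sum fun p hp => StableOn.smul _ ?_
  rw [Finset.mem_product, Finset.mem_Icc, Finset.mem_Icc] at hp
  exact stableOn_normalOrd hp.1.1 hp.2.2

theorem LowerTri.stableOn_clifford (A : LowerTri) {N : ℤ} (hN : 0 ≤ N) :
    StableOn (Maya.window N) A.clifford := fun v hv S hS => by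
  rw [A.clifford_apply_of_mem_window hN v hS]
  exact A.stableOn_truncClifford N v hv S hS

theorem LowerTri.block_clifford [DecidableEq Maya] (A : LowerTri) {N : ℤ} (hN : 0 ≤ N) :
    block (Maya.window N) A.clifford = block (Maya.window N) (A.truncClifford N) := by
  ext s t
  exact A.clifford_apply_of_mem_window hN _ s.2

/-! ### Rows of `ψ*` and columns of `ψ` -/

namespace LowerTri

variable (A B : LowerTri) (N : ℤ)

/-- `∑ⱼ B_{ij} ψ*_j`, the sum being over `-N ≤ j ≤ N`. -/
noncomputable def rowPsiStar (i : ℤ) : Module.End ℂ Fock :=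
  ∑ j ∈ Finset.Icc (-N) N, B.entry i j • psiStar j

/-- `∑ᵢ B_{ij} ψ_i`, the sum being over `-N ≤ i ≤ N`. -/
noncomputable def colPsi (j : ℤ) : Module.End ℂ Fock :=
  ∑ i ∈ Finset.Icc (-N) N, B.entry i j • psi i

theorem entry_mul_of_mem_window {i j : ℤ} (hi : i ≤ N) (hj : -N ≤ j) :
    (A * B).entry i j = ∑ l ∈ Finset.Icc (-N) N, A.entry i l * B.entry l j := by
  rw [entry_mul]
  refine Finset.sum_subset (Finset.Icc_subset_Icc hj hi) fun l _ hl => ?_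
  rw [Finset.mem_Icc, not_and_or, not_le, not_le] at hl
  rcases hl with hl | hl
  · rw [B.entry_eq_zero hl, mul_zero]
  · rw [A.entry_eq_zero hl, zero_mul]

variable {N} in
theorem rowPsiStar_one {i : ℤ} (hi : i ∈ Finset.Icc (-N) N) :
    rowPsiStar 1 N i = psiStar i := by
  unfold rowPsiStar
  rw [Finset.sum_eq_single_of_mem i hi]
  · rw [entry_one, if_pos rfl, one_smul]
  · intro j _ hj
    rw [entry_one, if_neg hj.symm, zero_smul]

variable {N} in
theorem colPsi_one {j : ℤ} (hj : j ∈ Finset.Icc (-N) N) : colPsi 1 N j = psi j := by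
  unfold colPsi
  rw [Finset.sum_eq_single_of_mem j hj]
  · rw [entry_one, if_pos rfl, one_smul]
  · intro i _ hi
    rw [entry_one, if_neg hi, zero_smul]

theorem stableOn_rowPsiStar (i : ℤ) : StableOn (Maya.window N) (B.rowPsiStar N i) :=
  StableOn.sum fun _ hj => (stableOn_psiStar (Finset.mem_Icc.mp hj).2).smul _

theorem stableOn_colPsi (j : ℤ) : StableOn (Maya.window N) (B.colPsi N j) :=
  StableOn.sum fun _ hi => (stableOn_psi (Finset.mem_Icc.mp hi).1).smul _

variable {N} in
theorem rowPsiStar_mul_normalOrd (i : ℤ) {a : ℤ} (ha : a ∈ Finset.Icc (-N) N) (b : ℤ) :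
    B.rowPsiStar N i * normalOrd a b =
      normalOrd a b * B.rowPsiStar N i + B.entry i a • psiStar b := by
  unfold rowPsiStar
  rw [Finset.sum_mul, Finset.mul_sum]
  simp_rw [smul_mul_assoc, psiStar_mul_normalOrd, smul_add, mul_smul_comm, smul_ite, smul_zero]
  rw [Finset.sum_add_distrib, Finset.sum_ite_eq' _ a, if_pos ha]

variable {N} in
theorem colPsi_mul_normalOrd (j a : ℤ) {b : ℤ} (hb : b ∈ Finset.Icc (-N) N) :
    B.colPsi N j * normalOrd a b =
      normalOrd a b * B.colPsi N j - B.entry b j • psi a := by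
  unfold colPsi
  rw [Finset.sum_mul, Finset.mul_sum]
  simp_rw [smul_mul_assoc, psi_mul_normalOrd, smul_sub, mul_smul_comm, smul_ite, smul_zero]
  rw [Finset.sum_sub_distrib, Finset.sum_ite_eq _ b, if_pos hb]

/-- Commuting with `∑ A_{ab} :ψ_a ψ*_b:` multiplies the row of coefficients by `A` on the right. -/
theorem rowPsiStar_mul_truncClifford {i : ℤ} (hi : i ≤ N) :
    B.rowPsiStar N i * A.truncClifford N =
      A.truncClifford N * B.rowPsiStar N i + (B * A).rowPsiStar N i := by
  have h : ∀ p ∈ Finset.Icc (-N) N ×ˢ Finset.Icc (-N) N,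
      B.rowPsiStar N i * (A.entry p.1 p.2 • normalOrd p.1 p.2) =
        A.entry p.1 p.2 • normalOrd p.1 p.2 * B.rowPsiStar N i +
          (B.entry i p.1 * A.entry p.1 p.2) • psiStar p.2 := fun p hp => by
    rw [mul_smul_comm, B.rowPsiStar_mul_normalOrd i (Finset.mem_product.mp hp).1, smul_add,
      smul_mul_assoc, smul_smul, mul_comm (A.entry _ _)]
  rw [truncClifford, Finset.mul_sum, Finset.sum_congr rfl h, Finset.sum_add_distrib,
    Finset.sum_mul, Finset.sum_product_right]
  congr 1
  rw [Finset.sum_product_right]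
  refine Finset.sum_congr rfl fun b hb => ?_
  rw [B.entry_mul_of_mem_window A N hi (Finset.mem_Icc.mp hb).1, Finset.sum_smul]

/-- Commuting with `∑ A_{ab} :ψ_a ψ*_b:` multiplies the column of coefficients by `-A` on the
left. -/
theorem colPsi_mul_truncClifford {j : ℤ} (hj : -N ≤ j) :
    B.colPsi N j * A.truncClifford N =
      A.truncClifford N * B.colPsi N j - (A * B).colPsi N j := by
  have h : ∀ p ∈ Finset.Icc (-N) N ×ˢ Finset.Icc (-N) N,
      B.colPsi N j * (A.entry p.1 p.2 • normalOrd p.1 p.2) =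
        A.entry p.1 p.2 • normalOrd p.1 p.2 * B.colPsi N j -
          (A.entry p.1 p.2 * B.entry p.2 j) • psi p.1 := fun p hp => by
    rw [mul_smul_comm, B.colPsi_mul_normalOrd j p.1 (Finset.mem_product.mp hp).2, smul_sub,
      smul_mul_assoc, smul_smul]
  rw [truncClifford, Finset.mul_sum, Finset.sum_congr rfl h, Finset.sum_sub_distrib,
    Finset.sum_mul]
  congr 1
  rw [Finset.sum_product]
  refine Finset.sum_congr rfl fun a ha => ?_
  rw [A.entry_mul_of_mem_window B N (Finset.mem_Icc.mp ha).2 hj, Finset.sum_smul]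

end LowerTri

/-! ### Conjugation of the fermions -/

section Conjugation

variable [DecidableEq Maya] {A : LowerTri} {g : LowerTriˣ} {G : (Module.End ℂ Fock)ˣ} {N : ℤ}

/-- `ĝ⁻¹ ψ*_i ĝ = ∑ⱼ g_{ij} ψ*_j` on a window. -/
theorem block_inv_mul_psiStar_mul (hg : A.IsExp (g : LowerTri))
    (hG : IsFockExp A.clifford (G : Module.End ℂ Fock))
    (hG' : IsFockExp (-A.clifford) (↑G⁻¹ : Module.End ℂ Fock)) {i : ℤ} (hN : 0 ≤ N)
    (hi : i ∈ Finset.Icc (-N) N) :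
    block (Maya.window N) (↑G⁻¹ * psiStar i * ↑G) =
      block (Maya.window N) ((g : LowerTri).rowPsiStar N i) := by
  have hX := A.stableOn_clifford hN
  have hS := stableOn_psiStar (Finset.mem_Icc.mp hi).2
  have key := Matrix.mul_exp_eq_exp_mul_of_shift
    (M := block (Maya.window N) A.clifford)
    (P := fun l => block (Maya.window N) ((A ^ l).rowPsiStar N i))
    (Q := block (Maya.window N) ((g : LowerTri).rowPsiStar N i)) (fun l => ?_) (fun s t => ?_)
  · rw [← hG.block_eq hX] at key
    simp only [pow_zero, LowerTri.rowPsiStar_one hi] at key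
    have hGi := hG'.stableOn hX.neg
    rw [mul_assoc, hGi.block_mul, hS.block_mul, key, ← mul_assoc, ← hGi.block_mul,
      Units.inv_mul, block_one, one_mul]
  · rw [A.block_clifford hN, ← ((A ^ l).stableOn_rowPsiStar N i).block_mul,
      A.rowPsiStar_mul_truncClifford (A ^ l) N (Finset.mem_Icc.mp hi).2, map_add,
      (A.stableOn_truncClifford N).block_mul, ← pow_succ]
  · simp only [LowerTri.rowPsiStar, map_sum, map_smul, Matrix.sum_apply, Matrix.smul_apply,
      smul_eq_mul, Finset.mul_sum, ← mul_assoc]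
    exact hasSum_sum fun j _ => (hg i j).mul_right _

/-- `ĝ⁻¹ ψ_j ĝ = ∑ᵢ (g⁻¹)_{ij} ψ_i` on a window. Exponentiating the negative of the operator makes
only `e^A = g` enter, and not `e^{-A} = g⁻¹`. -/
theorem block_inv_mul_psi_mul (hg : A.IsExp (g : LowerTri))
    (hG' : IsFockExp (-A.clifford) (↑G⁻¹ : Module.End ℂ Fock)) {j : ℤ} (hN : 0 ≤ N)
    (hj : j ∈ Finset.Icc (-N) N) :
    block (Maya.window N) (↑G⁻¹ * psi j * ↑G) =
      block (Maya.window N) ((↑g⁻¹ : LowerTri).colPsi N j) := by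
  have hX := A.stableOn_clifford hN
  have hS := stableOn_psi (Finset.mem_Icc.mp hj).1
  -- The columns `Aˡ g⁻¹` sum, with weights `1 / l!`, to those of `g g⁻¹ = 1`.
  have key := Matrix.mul_exp_eq_exp_mul_of_shift
    (M := block (Maya.window N) (-A.clifford))
    (P := fun l => block (Maya.window N) ((A ^ l * ↑g⁻¹ : LowerTri).colPsi N j))
    (Q := block (Maya.window N) ((g * ↑g⁻¹ : LowerTri).colPsi N j)) (fun l => ?_)
    (fun s t => ?_)
  · rw [← hG'.block_eq hX.neg] at key
    simp only [pow_zero, one_mul, Units.mul_inv, LowerTri.colPsi_one hj] at key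
    have hGi := hG'.stableOn hX.neg
    rw [(hGi.mul hS).block_mul, hGi.block_mul, ← key, mul_assoc, ← hGi.block_mul,
      Units.inv_mul, block_one, mul_one]
  · rw [map_neg, A.block_clifford hN, mul_neg,
      ← ((A ^ l * ↑g⁻¹ : LowerTri).stableOn_colPsi N j).block_mul,
      A.colPsi_mul_truncClifford _ N (Finset.mem_Icc.mp hj).1, map_sub,
      (A.stableOn_truncClifford N).block_mul, ← mul_assoc, ← pow_succ', neg_mul]
    abel
  · simp only [LowerTri.colPsi, map_sum, map_smul, Matrix.sum_apply, Matrix.smul_apply,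
      smul_eq_mul, Finset.mul_sum, ← mul_assoc]
    refine hasSum_sum fun i hi => HasSum.mul_right _ ?_
    simp only [LowerTri.entry_mul_of_mem_window _ _ N (Finset.mem_Icc.mp hi).2
      (Finset.mem_Icc.mp hj).1, Finset.mul_sum, ← mul_assoc]
    exact hasSum_sum fun l _ => (hg i l).mul_right _

end Conjugation

/-! ### Adapted bases as vacuum expectation values -/

theorem LowerTri.act_zMonomial (g : LowerTri) (m n : ℤ) :
    (g.act (zMonomial m) : FormalSeries) n = g.entry (-n - 1) (-m - 1) := by
  change ∑ᶠ j, g.entry (-n - 1) j * (if -j - 1 = m then 1 else 0) = _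
  rw [finsum_eq_single _ (-m - 1)]
  · rw [if_pos (by ring), mul_one]
  · intro j hj
    rw [if_neg (by omega), mul_zero]

theorem adaptedBasis_apply (g : LowerTriˣ) (k n : ℤ) :
    (adaptedBasis g k : FormalSeries) n = (g : LowerTri).entry (-n - 1) (-k) := by
  rw [adaptedBasis, LowerTri.act_zMonomial]
  congr 1
  ring

theorem dualAdaptedBasis_apply (g : LowerTriˣ) (k n : ℤ) :
    (dualAdaptedBasis g k : FormalSeries) n = (↑g⁻¹ : LowerTri).entry (k - 1) n := by
  rw [dualAdaptedBasis, LowerTri.act_zMonomial]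
  change (LowerTri.tildeT (↑g⁻¹ : LowerTri)).entry _ _ = _
  rw [LowerTri.entry_tildeT]
  congr 1 <;> ring

theorem vev_sum_smul {κ : Type*} (J : Finset κ) (c : κ → ℂ) (Z : κ → Module.End ℂ Fock) :
    vev (∑ k ∈ J, c k • Z k) = ∑ k ∈ J, c k * vev (Z k) := by
  unfold vev
  rw [LinearMap.sum_apply, Finset.sum_apply]
  rfl

theorem vev_congr [DecidableEq Maya] {N : ℤ} (hN : 0 ≤ N) {X Y : Module.End ℂ Fock}
    (hX : StableOn (Maya.window N) X) (hY : StableOn (Maya.window N) Y)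
    (h : block (Maya.window N) X = block (Maya.window N) Y) : vev X = vev Y :=
  hX.apply_congr hY h _ (Maya.vac_mem_window hN)

section Expectation

variable {A : LowerTri} {g : LowerTriˣ} {G : (Module.End ℂ Fock)ˣ}

/-- Between `L` and `R`, `ĝ⁻¹ ψ*_i ĝ` contributes `∑ⱼ g_{ij} ⟨0| L ψ*_j R |0⟩`, where by hypothesis
only the summand `j = a` is non-zero. Stability of `L` and `R` reduces this to a finite sum. -/
theorem vev_conj_psiStar (hg : A.IsExp (g : LowerTri))
    (hG : IsFockExp A.clifford (G : Module.End ℂ Fock))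
    (hG' : IsFockExp (-A.clifford) (↑G⁻¹ : Module.End ℂ Fock)) (i a : ℤ)
    {L R : Module.End ℂ Fock} (hL : ∀ N, |a| ≤ N → StableOn (Maya.window N) L)
    (hR : ∀ N, |a| ≤ N → StableOn (Maya.window N) R)
    (h : ∀ j, vev (L * psiStar j * R) = if j = a then 1 else 0) :
    vev (L * (↑G⁻¹ * psiStar i * ↑G) * R) = (g : LowerTri).entry i a := by
  classical
  obtain ⟨N, hN⟩ : ∃ N, N = max |a| |i| := ⟨_, rfl⟩
  have ha : |a| ≤ N := hN ▸ le_max_left _ _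
  have hi : |i| ≤ N := hN ▸ le_max_right _ _
  have hN0 : 0 ≤ N := (abs_nonneg a).trans ha
  have hX := A.stableOn_clifford hN0
  have hY := ((hG'.stableOn hX.neg).mul (stableOn_psiStar (abs_le.mp hi).2)).mul (hG.stableOn hX)
  have hZ := (g : LowerTri).stableOn_rowPsiStar N i
  rw [vev_congr hN0 (((hL N ha).mul hY).mul (hR N ha)) (((hL N ha).mul hZ).mul (hR N ha))]
  · unfold LowerTri.rowPsiStar
    simp_rw [Finset.mul_sum, Finset.sum_mul, mul_smul_comm, smul_mul_assoc]
    rw [vev_sum_smul]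
    simp_rw [h, mul_ite, mul_one, mul_zero]
    rw [Finset.sum_ite_eq', if_pos (Finset.mem_Icc.mpr (abs_le.mp ha))]
  · rw [((hL N ha).mul hY).block_mul, ((hL N ha).mul hZ).block_mul, (hL N ha).block_mul,
      (hL N ha).block_mul,
      block_inv_mul_psiStar_mul hg hG hG' hN0 (Finset.mem_Icc.mpr (abs_le.mp hi))]

theorem vev_conj_psi (hg : A.IsExp (g : LowerTri))
    (hG : IsFockExp A.clifford (G : Module.End ℂ Fock))
    (hG' : IsFockExp (-A.clifford) (↑G⁻¹ : Module.End ℂ Fock)) (j a : ℤ)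
    {L R : Module.End ℂ Fock} (hL : ∀ N, |a| ≤ N → StableOn (Maya.window N) L)
    (hR : ∀ N, |a| ≤ N → StableOn (Maya.window N) R)
    (h : ∀ i, vev (L * psi i * R) = if i = a then 1 else 0) :
    vev (L * (↑G⁻¹ * psi j * ↑G) * R) = (↑g⁻¹ : LowerTri).entry a j := by
  classical
  obtain ⟨N, hN⟩ : ∃ N, N = max |a| |j| := ⟨_, rfl⟩
  have ha : |a| ≤ N := hN ▸ le_max_left _ _
  have hj : |j| ≤ N := hN ▸ le_max_right _ _
  have hN0 : 0 ≤ N := (abs_nonneg a).trans ha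
  have hX := A.stableOn_clifford hN0
  have hY := ((hG'.stableOn hX.neg).mul (stableOn_psi (abs_le.mp hj).1)).mul (hG.stableOn hX)
  have hZ := (↑g⁻¹ : LowerTri).stableOn_colPsi N j
  rw [vev_congr hN0 (((hL N ha).mul hY).mul (hR N ha)) (((hL N ha).mul hZ).mul (hR N ha))]
  · unfold LowerTri.colPsi
    simp_rw [Finset.mul_sum, Finset.sum_mul, mul_smul_comm, smul_mul_assoc]
    rw [vev_sum_smul]
    simp_rw [h, mul_ite, mul_one, mul_zero]
    rw [Finset.sum_ite_eq', if_pos (Finset.mem_Icc.mpr (abs_le.mp ha))]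
  · rw [((hL N ha).mul hY).block_mul, ((hL N ha).mul hZ).block_mul, (hL N ha).block_mul,
      (hL N ha).block_mul,
      block_inv_mul_psi_mul hg hG' hN0 (Finset.mem_Icc.mpr (abs_le.mp hj))]

end Expectation

theorem mainTheorem10 (A : LowerTri) (g : LowerTriˣ) (hg : LowerTri.IsExp A (g : LowerTri)) :
    ∃ G : (Module.End ℂ Fock)ˣ, IsFockExp A.clifford (G : Module.End ℂ Fock) ∧
      ∀ k : ℤ,
        (1 ≤ k → (adaptedBasis g k : FormalSeries) =
          vevSeries (psi (-k) * ↑G⁻¹) psiStarField ↑G) ∧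
        (k ≤ 0 → (adaptedBasis g k : FormalSeries) =
          vevSeries (↑G⁻¹) psiStarField (↑G * psi (-k))) ∧
        (1 ≤ k → (dualAdaptedBasis g k : FormalSeries) =
          vevSeries (psiStar (k - 1) * ↑G⁻¹) psiField ↑G) ∧
        (k ≤ 0 → (dualAdaptedBasis g k : FormalSeries) =
          vevSeries (↑G⁻¹) psiField (↑G * psiStar (k - 1))) := by
  obtain ⟨G, hG, hG'⟩ := exists_unit_isFockExp (X := A.clifford) fun S => by
    obtain ⟨N, hN, hS⟩ := S.exists_mem_window
    exact ⟨_, hS, A.stableOn_clifford hN⟩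
  have h1 : ∀ N : ℤ, StableOn (Maya.window N) 1 := fun _ => StableOn.one
  have hpsi : ∀ a N : ℤ, |a| ≤ N → StableOn (Maya.window N) (psi a) := fun a N h =>
    stableOn_psi (abs_le.mp h).1
  have hstar : ∀ a N : ℤ, |a| ≤ N → StableOn (Maya.window N) (psiStar a) := fun a N h =>
    stableOn_psiStar (abs_le.mp h).2
  refine ⟨G, hG, fun k => ⟨fun hk => ?_, fun hk => ?_, fun hk => ?_, fun hk => ?_⟩⟩ <;>
    funext n
  · rw [adaptedBasis_apply, ← vev_conj_psiStar hg hG hG' (-n - 1) (-k) (hpsi _) (fun N _ => h1 N)]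
    · simp only [vevSeries, psiStarField, mul_assoc, mul_one]
    · intro j
      rw [mul_one, vev_psi_mul_psiStar]
      exact if_congr (and_iff_left (by omega)) rfl rfl
  · rw [adaptedBasis_apply, ← vev_conj_psiStar hg hG hG' (-n - 1) (-k) (fun N _ => h1 N) (hpsi _)]
    · simp only [vevSeries, psiStarField, mul_assoc, one_mul]
    · intro j
      rw [one_mul, vev_psiStar_mul_psi]
      exact if_congr (and_iff_left (by omega)) rfl rfl
  · rw [dualAdaptedBasis_apply,
      ← vev_conj_psi hg hG hG' n (k - 1) (hstar _) (fun N _ => h1 N)]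
    · simp only [vevSeries, psiField, mul_assoc, mul_one]
    · intro i
      rw [mul_one, vev_psiStar_mul_psi]
      exact if_congr ⟨fun h => h.1.symm, fun h => ⟨h.symm, by omega⟩⟩ rfl rfl
  · rw [dualAdaptedBasis_apply,
      ← vev_conj_psi hg hG hG' n (k - 1) (fun N _ => h1 N) (hstar _)]
    · simp only [vevSeries, psiField, mul_assoc, one_mul]
    · intro i
      rw [one_mul, vev_psi_mul_psiStar]
      exact if_congr ⟨fun h => h.1.symm, fun h => ⟨h.symm, by omega⟩⟩ rfl rfl
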